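/- For each integer $n\ge 2$ let $e_1,e_2,\dots$ be independent random edges, each uniformly distributed over the $\binom n2$ pairs $\{u,v\}$ of distinct elements of $[n]=\{1,\dots,n\}$, and for every integer $t\ge 0$ let $G_t$ be the multigraph on vertex set $[n]$ whose edges are $e_1,\dots,e_t$, counted with repetition (so $G_0$ has no edges, and $G_t$ is obtained from $G_{t-1}$ by adding $e_t$). Let $\varepsilon>0$ be fixed. Then \[ \mathbb P(G_t\text{ is connected})\le n^{-\varepsilon+o(1)}\quad\text{for } t\le \tfrac{n\log n}{2}(1-\varepsilon), \] \[ \mathbb P(G_t\text{ is connected})\ge 1-n^{-\varepsilon+o(1)}\quad\text{for } t\ge \tfrac{n\log n}{2}(1+\varepsilon). \] Here $\log$ is the natural logarithm and $o(1)$ stands for a quantity that depends only on $n$ and $\varepsilon$ (not on $t$) and tends to $0$ as $n\to\infty$. That is, for each of the two bounds there is a function $\delta:\mathbb N\to\mathbb R$, depending only on $\varepsilon$, with $\delta(n)\to 0$ such that the bound, with $\delta(n)$ in place of $o(1)$, holds for all $n\ge 2$ and all integers $t\ge 0$ in the stated range. -/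

import Mathlib

open MeasureTheory ProbabilityTheory Filter Topology

namespace RandomMultigraph

/-- A multigraph is connected if it has a vertex and any two of its vertices are joined by
a path, that is, by a finite chain of successively adjacent vertices. -/
def IsConnected {α β : Type*} (G : Graph α β) : Prop :=
  G.vertexSet.Nonempty ∧
    ∀ x ∈ G.vertexSet, ∀ y ∈ G.vertexSet, Relation.ReflTransGen G.Adj x y

/-- The `n.choose 2` possible edges on the vertex set `Fin n`: unordered pairs of distinct
vertices. -/
def Edge (n : ℕ) : Type := {e : Sym2 (Fin n) // ¬ e.IsDiag}

instance edgeMeasurableSpace (n : ℕ) : MeasurableSpace (Edge n) := ⊤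

/-- The multigraph on `Fin n` obtained from the empty graph by adding the first `t` edges
`e 0, …, e (t - 1)` of the sequence `e`, with repetition. The edge added at the step from
time `s` to time `s + 1` carries the label `s`, so that repeated edges stay distinct. -/
def multigraph {n : ℕ} (e : ℕ → Edge n) (t : ℕ) : Graph (Fin n) ℕ where
  vertexSet := Set.univ
  IsLink s x y := s < t ∧ (e s).1 = s(x, y)
  isLink_symm := fun _ _ => ⟨fun _ _ h => ⟨h.1, h.2.trans Sym2.eq_swap⟩⟩
  eq_or_eq_of_isLink_of_isLink := by
    rintro s x y v w ⟨_, h⟩ ⟨_, h'⟩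
    rcases Sym2.eq_iff.1 (h.symm.trans h') with h | h
    · exact Or.inl h.1
    · exact Or.inr h.1
  left_mem_of_isLink := fun _ _ _ _ => Set.mem_univ _

/-- The random edges `e 0, e 1, …` are independent and each is uniformly distributed over all
possible edges on `Fin n`. -/
structure IsUniformEdgeSequence {n : ℕ} {Ω : Type*} [MeasurableSpace Ω] (P : Measure Ω)
    (e : ℕ → Ω → Edge n) : Prop where
  measurable : ∀ s, Measurable (e s)
  indep : iIndepFun e P
  uniform : ∀ (s : ℕ) (a : Edge n), P.real {ω | e s ω = a} = 1 / (n.choose 2 : ℝ)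

end RandomMultigraph

namespace RandomMultigraph

/-! A multigraph is disconnected exactly when no edge crosses some cut, and a fixed cut of size `k`
is missed by `t` edges with probability `(1 - p) ^ t`, where `p = k (n - k) / n.choose 2`. Below the
threshold, singleton cuts suffice: with `a = (1 - 2 / n) ^ t`, about `n a ≥ n ^ (ε + o(1))` isolated
vertices are expected, and isolation of distinct vertices is nonpositively correlated, so Chebyshev
gives probability at most `1 / (n a)` of having none (`measureReal_forall_notMem_le`). Above it, a
union bound over cuts with `k ≤ n / 2` is used. Each cut costs at most `n ^ (-c) * n ^ (-ε)` with `c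
= k (n - k) / (n - 1) ≥ 1`, and `n.choose k * n ^ (-c)` is dominated by a convergent series
independent of `n` (`choose_mul_rpow_le`), so the total is `O(n ^ (-ε))`. -/

noncomputable instance edgeFintype (n : ℕ) : Fintype (Edge n) := by
  unfold Edge; exact Fintype.ofFinite _

/-! ### Cuts and connectivity. -/

open Classical in
/-- The edges with exactly one end in `S`. -/
noncomputable def crossing {n : ℕ} (S : Finset (Fin n)) : Finset (Edge n) :=
  Finset.univ.filter fun e => ∃ x ∈ S, ∃ y ∉ S, e.1 = s(x, y)

lemma mem_crossing {n : ℕ} {S : Finset (Fin n)} {e : Edge n} :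
    e ∈ crossing S ↔ ∃ x ∈ S, ∃ y ∉ S, e.1 = s(x, y) := by
  simp [crossing]

lemma card_crossing {n : ℕ} (S : Finset (Fin n)) :
    (crossing S).card = S.card * (n - S.card) := by
  have h : (S ×ˢ Sᶜ).card = (crossing S).card := by
    refine Finset.card_bij (fun p hp => ⟨s(p.1, p.2), ?_⟩) ?_ ?_ ?_
    · rw [Finset.mem_product, Finset.mem_compl] at hp
      rw [Sym2.mk_isDiag_iff]
      rintro h
      exact hp.2 (h ▸ hp.1)
    · intro p hp
      rw [Finset.mem_product, Finset.mem_compl] at hp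
      exact mem_crossing.2 ⟨p.1, hp.1, p.2, hp.2, rfl⟩
    · intro p hp p' hp' h
      rw [Finset.mem_product, Finset.mem_compl] at hp hp'
      rcases Sym2.eq_iff.1 (congrArg Subtype.val h) with h | h
      · exact Prod.ext h.1 h.2
      · exact absurd (h.1 ▸ hp.1) hp'.2
    · rintro e he
      obtain ⟨x, hx, y, hy, h⟩ := mem_crossing.1 he
      exact ⟨(x, y), by simp [hx, hy], Subtype.ext h.symm⟩
  rw [← h, Finset.card_product, Finset.card_compl, Fintype.card_fin]

-- The stars at `u` and `v` share at most the edge `s(u, v)`, hence the `+ 1`.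
open Classical in
lemma card_crossing_union {n : ℕ} {u v : Fin n} (huv : u ≠ v) :
    2 * (n - 1) ≤ (crossing {u} ∪ crossing {v}).card + 1 := by
  have hi : (crossing {u} ∩ crossing {v}).card ≤ 1 := by
    have key : ∀ a ∈ crossing {u} ∩ crossing {v}, a.1 = s(u, v) := by
      intro a ha
      rw [Finset.mem_inter, mem_crossing, mem_crossing] at ha
      obtain ⟨⟨x, hx, y, -, h⟩, ⟨x', hx', y', -, h'⟩⟩ := ha
      rw [Finset.mem_singleton] at hx hx'
      subst hx hx'
      exact (Sym2.mem_and_mem_iff huv).1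
        ⟨h ▸ Sym2.mem_mk_left _ _, h' ▸ Sym2.mem_mk_left _ _⟩
    exact Finset.card_le_one.2 fun a ha b hb => Subtype.ext ((key a ha).trans (key b hb).symm)
  have h := Finset.card_union_add_card_inter (crossing {u}) (crossing {v})
  rw [card_crossing, card_crossing] at h
  simp only [Finset.card_singleton] at h
  omega

lemma IsConnected.exists_mem_crossing {n t : ℕ} {e : ℕ → Edge n}
    (h : IsConnected (multigraph e t)) {S : Finset (Fin n)} (hS : S.Nonempty)
    (hS' : S ≠ Finset.univ) : ∃ s < t, e s ∈ crossing S := by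
  by_contra! hc
  obtain ⟨x, hx⟩ := hS
  refine hS' (Finset.eq_univ_of_forall fun y => ?_)
  have hxy := h.2 x (Set.mem_univ _) y (Set.mem_univ _)
  induction hxy with
  | refl => exact hx
  | tail _ hab ih =>
    obtain ⟨s, hs, hl⟩ := hab
    by_contra hb
    exact hc s hs (mem_crossing.2 ⟨_, ih, _, hb, hl⟩)

lemma exists_cut_of_not_isConnected {n t : ℕ} (hn : 0 < n) {e : ℕ → Edge n}
    (h : ¬ IsConnected (multigraph e t)) :
    ∃ S : Finset (Fin n), S.Nonempty ∧ 2 * S.card ≤ n ∧ ∀ s < t, e s ∉ crossing S := by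
  classical
  have hne : (multigraph e t).vertexSet.Nonempty := ⟨⟨0, hn⟩, Set.mem_univ _⟩
  simp only [IsConnected, hne, true_and] at h
  push Not at h
  obtain ⟨x, -, y, -, hxy⟩ := h
  -- The component of `x` is uncrossed, and so is its complement; the smaller of the two is the cut.
  set R : Finset (Fin n) :=
    Finset.univ.filter fun z => Relation.ReflTransGen (multigraph e t).Adj x z with hR
  have hR1 : R.Nonempty := ⟨x, by simp [hR, Relation.ReflTransGen.refl]⟩
  have hR2 : Rᶜ.Nonempty := ⟨y, by simpa [hR] using hxy⟩
  have hcut : ∀ s < t, ∀ a ∈ R, ∀ b ∉ R, (e s).1 ≠ s(a, b) := by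
    intro s hs a ha b hb hl
    simp only [hR, Finset.mem_filter, Finset.mem_univ, true_and] at ha hb
    exact hb (ha.tail ⟨s, hs, hl⟩)
  have hcard := Finset.card_add_card_compl R
  rw [Fintype.card_fin] at hcard
  rcases le_total (2 * R.card) n with h2 | h2
  · refine ⟨R, hR1, h2, fun s hs hm => ?_⟩
    obtain ⟨a, ha, b, hb, hl⟩ := mem_crossing.1 hm
    exact hcut s hs a ha b hb hl
  · refine ⟨Rᶜ, hR2, by omega, fun s hs hm => ?_⟩
    obtain ⟨a, ha, b, hb, hl⟩ := mem_crossing.1 hm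
    rw [Finset.mem_compl] at ha
    rw [Finset.mem_compl, not_not] at hb
    exact hcut s hs b hb a ha (hl.trans Sym2.eq_swap)

/-! ### Probability that the first `t` edges avoid a given set. -/

section Probability

variable {n : ℕ} {Ω : Type*} [MeasurableSpace Ω] {P : Measure Ω} {e : ℕ → Ω → Edge n}

lemma IsUniformEdgeSequence.measureReal_mem [IsProbabilityMeasure P] (h : IsUniformEdgeSequence P e)
    (B : Finset (Edge n)) (s : ℕ) :
    P.real {ω | e s ω ∈ B} = B.card / (n.choose 2 : ℝ) := by
  have hset : {ω | e s ω ∈ B} = ⋃ a ∈ B, {ω | e s ω = a} := by ext; simp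
  rw [hset, measureReal_biUnion_finset]
  · simp [h.uniform, div_eq_mul_inv]
  · intro a _ b _ hab
    exact Set.disjoint_left.2 fun ω ha hb => hab (ha.symm.trans hb)
  · intro a _
    exact h.measurable s (MeasurableSpace.measurableSet_top (s := {a}))

lemma IsUniformEdgeSequence.measurableSet_avoid (h : IsUniformEdgeSequence P e)
    (B : Finset (Edge n)) (t : ℕ) : MeasurableSet {ω | ∀ s < t, e s ω ∉ B} := by
  have hset : {ω | ∀ s < t, e s ω ∉ B} = ⋂ s ∈ Finset.range t, e s ⁻¹' (B : Set (Edge n))ᶜ := by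
    ext; simp
  rw [hset]
  exact Finset.measurableSet_biInter _ fun s _ =>
    h.measurable s (MeasurableSpace.measurableSet_top)

lemma IsUniformEdgeSequence.measureReal_avoid [IsProbabilityMeasure P]
    (h : IsUniformEdgeSequence P e) (B : Finset (Edge n)) (t : ℕ) :
    P.real {ω | ∀ s < t, e s ω ∉ B} = (1 - B.card / (n.choose 2 : ℝ)) ^ t := by
  have hset : {ω | ∀ s < t, e s ω ∉ B} = ⋂ s ∈ Finset.range t, e s ⁻¹' (B : Set (Edge n))ᶜ := by
    ext; simp
  have hone : ∀ s, (P (e s ⁻¹' (B : Set (Edge n))ᶜ)).toReal = 1 - B.card / (n.choose 2 : ℝ) := by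
    intro s
    rw [← h.measureReal_mem B s, Set.preimage_compl]
    exact probReal_compl_eq_one_sub (h.measurable s (MeasurableSpace.measurableSet_top))
  rw [hset, measureReal_def, h.indep.measure_inter_preimage_eq_mul (Finset.range t)
    (fun _ _ => MeasurableSpace.measurableSet_top), ENNReal.toReal_prod]
  rw [Finset.prod_congr rfl fun s _ => hone s, Finset.prod_const, Finset.card_range]

end Probability

/-! ### Below the threshold: isolated vertices. -/

/-- The second moment method for a finite family of events of equal probability `a` that are
pairwise nonpositively correlated: the probability that none occurs is at most `1 / (N a)`. -/
lemma measureReal_forall_notMem_le {ι Ω : Type*} [Fintype ι] [Nonempty ι] [MeasurableSpace Ω]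
    {P : Measure Ω} [IsProbabilityMeasure P] {A : ι → Set Ω} (hA : ∀ i, MeasurableSet (A i))
    {a : ℝ} (ha : 0 < a) (h1 : ∀ i, P.real (A i) = a)
    (h2 : ∀ i j, i ≠ j → P.real (A i ∩ A j) ≤ a ^ 2) :
    P.real {ω | ∀ i, ω ∉ A i} ≤ 1 / (Fintype.card ι * a) := by
  classical
  set m : ℝ := Fintype.card ι * a with hm
  have hN : (0 : ℝ) < Fintype.card ι := by exact_mod_cast Fintype.card_pos
  have hm0 : 0 < m := by positivity
  set X : ι → Ω → ℝ := fun i => (A i).indicator 1 with hX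
  have hXi : ∀ i, Integrable (X i) P := fun i =>
    (integrable_const (1 : ℝ)).indicator (hA i)
  have hXX : ∀ i j, (fun ω => X i ω * X j ω) = (A i ∩ A j).indicator 1 := by
    intro i j
    rw [Set.inter_indicator_one]; rfl
  have hXXi : ∀ i j, Integrable (fun ω => X i ω * X j ω) P := fun i j => by
    rw [hXX]
    exact (integrable_const (1 : ℝ)).indicator ((hA i).inter (hA j))
  have hexp : ∀ ω, (∑ i, X i ω - m) ^ 2
      = ∑ i, ∑ j, X i ω * X j ω - 2 * m * ∑ i, X i ω + m ^ 2 := by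
    intro ω
    rw [← Finset.sum_mul_sum]; ring
  have hi1 : Integrable (fun ω => ∑ i, ∑ j, X i ω * X j ω) P :=
    integrable_finsetSum _ fun i _ => integrable_finsetSum _ fun j _ => hXXi i j
  have hi2 : Integrable (fun ω => 2 * m * ∑ i, X i ω) P :=
    (integrable_finsetSum _ fun i _ => hXi i).const_mul _
  have hint : Integrable (fun ω => (∑ i, X i ω - m) ^ 2) P := by
    simp only [hexp]
    exact (hi1.sub hi2).add (integrable_const _)
  -- The diagonal contributes `m` and the correlation bound at most `m ^ 2` to the second moment, so
  -- the variance is at most `m`.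
  have hval : ∫ ω, (∑ i, X i ω - m) ^ 2 ∂P ≤ m := by
    simp only [hexp]
    rw [integral_add (f := fun ω => ∑ i, ∑ j, X i ω * X j ω - 2 * m * ∑ i, X i ω)
      (hi1.sub hi2) (integrable_const _), integral_sub hi1 hi2,
      integral_finsetSum _ fun i _ => integrable_finsetSum _ fun j _ => hXXi i j,
      integral_const_mul, integral_finsetSum _ fun i _ => hXi i]
    have e1 : ∀ i, ∫ ω, X i ω ∂P = a := fun i => by
      rw [← h1 i]; exact integral_indicator_one (hA i)
    have e2 : ∀ i, ∫ ω, ∑ j, X i ω * X j ω ∂P ≤ a + Fintype.card ι * a ^ 2 := by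
      intro i
      rw [integral_finsetSum _ fun j _ => hXXi i j]
      have e3 : ∀ j, ∫ ω, X i ω * X j ω ∂P ≤ (if i = j then a else 0) + a ^ 2 := by
        intro j
        rw [hXX, integral_indicator_one ((hA i).inter (hA j))]
        split_ifs with hij
        · subst hij
          rw [Set.inter_self, h1]; nlinarith
        · simpa using h2 i j hij
      refine (Finset.sum_le_sum fun j _ => e3 j).trans_eq ?_
      simp [Finset.sum_add_distrib]
    have e4 := Finset.sum_le_sum fun i (_ : i ∈ Finset.univ) => e2 i
    simp only [e1, Finset.sum_const, Finset.card_univ, nsmul_eq_mul, integral_const,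
      probReal_univ, smul_eq_mul, one_mul] at e4 ⊢
    rw [← hm]
    have : (Fintype.card ι : ℝ) * (a + Fintype.card ι * a ^ 2) = m + m ^ 2 := by rw [hm]; ring
    nlinarith
  have hmeas : MeasurableSet {ω | ∀ i, ω ∉ A i} := by
    rw [Set.ofPred_forall]
    exact MeasurableSet.iInter fun i => (hA i).compl
  have hlow : m ^ 2 * P.real {ω | ∀ i, ω ∉ A i} ≤ ∫ ω, (∑ i, X i ω - m) ^ 2 ∂P := by
    have : m ^ 2 * P.real {ω | ∀ i, ω ∉ A i}
        = ∫ ω, m ^ 2 * ({ω | ∀ i, ω ∉ A i} : Set Ω).indicator 1 ω ∂P := by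
      rw [integral_const_mul, integral_indicator_one hmeas]
    rw [this]
    refine integral_mono (((integrable_const (1 : ℝ)).indicator hmeas).const_mul _) hint
      fun ω => ?_
    by_cases hω : ∀ i, ω ∉ A i
    · simp [hX, hω]
    · simp [hω, sq_nonneg]
  rw [le_div_iff₀ hm0]
  have := hlow.trans hval
  have h3 : m * (m * P.real {ω | ∀ i, ω ∉ A i}) ≤ m * 1 := by linarith
  linarith [le_of_mul_le_mul_left h3 hm0]

lemma cast_choose_two_eq (n : ℕ) : (n.choose 2 : ℝ) = n * (n - 1) / 2 :=
  Nat.cast_choose_two ℝ n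

lemma IsUniformEdgeSequence.measureReal_isConnected_le {n : ℕ} (hn : 3 ≤ n) {Ω : Type*}
    [MeasurableSpace Ω] {P : Measure Ω} [IsProbabilityMeasure P] {e : ℕ → Ω → Edge n}
    (h : IsUniformEdgeSequence P e) (t : ℕ) :
    P.real {ω | IsConnected (multigraph (fun s => e s ω) t)} ≤ 1 / (n * (1 - 2 / n : ℝ) ^ t) := by
  classical
  have hn' : (3 : ℝ) ≤ n := by exact_mod_cast hn
  have hnn : (0 : ℝ) < n - 1 := by linarith
  have : NeZero n := ⟨by omega⟩
  have hq : (0 : ℝ) < 1 - 2 / n := by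
    rw [sub_pos, div_lt_one (by linarith)]; linarith
  have key := measureReal_forall_notMem_le (P := P)
    (A := fun v : Fin n => {ω | ∀ s < t, e s ω ∉ crossing {v}})
    (fun v => h.measurableSet_avoid _ t) (pow_pos hq t) ?_ ?_
  · rw [Fintype.card_fin] at key
    refine le_trans (measureReal_mono ?_) key
    intro ω hω v hv
    obtain ⟨s, hs, hm⟩ := IsConnected.exists_mem_crossing hω (Finset.singleton_nonempty v)
      (fun hc => by
        have := congrArg Finset.card hc
        rw [Finset.card_singleton, Finset.card_univ, Fintype.card_fin] at this
        omega)
    exact hv s hs hm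
  · intro v
    rw [h.measureReal_avoid, card_crossing, cast_choose_two_eq, Finset.card_singleton, one_mul,
      Nat.cast_sub (by omega), Nat.cast_one]
    congr 2
    field_simp
  · intro u v huv
    have hset : {ω | ∀ s < t, e s ω ∉ crossing {u}} ∩ {ω | ∀ s < t, e s ω ∉ crossing {v}}
        = {ω | ∀ s < t, e s ω ∉ crossing {u} ∪ crossing {v}} := by
      ext ω
      simp only [Set.mem_inter_iff, Set.mem_ofPred_eq, Finset.mem_union, not_or]
      exact ⟨fun H s hs => ⟨H.1 s hs, H.2 s hs⟩,
        fun H => ⟨fun s hs => (H s hs).1, fun s hs => (H s hs).2⟩⟩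
    rw [hset, h.measureReal_avoid, ← pow_mul, mul_comm t 2, pow_mul]
    have hc := card_crossing_union huv
    have hc' : 2 * ((n : ℝ) - 1) ≤ (crossing {u} ∪ crossing {v}).card + 1 := by
      have : ((2 * (n - 1) : ℕ) : ℝ) ≤ (((crossing {u} ∪ crossing {v}).card + 1 : ℕ) : ℝ) := by
        exact_mod_cast hc
      rw [Nat.cast_mul, Nat.cast_sub (by omega)] at this
      push_cast at this
      exact this
    -- The ratio is a probability; this keeps the base of the power nonnegative.
    have hle : ((crossing {u} ∪ crossing {v}).card : ℝ) / n.choose 2 ≤ 1 := by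
      rw [← h.measureReal_mem _ 0]
      exact measureReal_le_one
    refine pow_le_pow_left₀ (by linarith) ?_ t
    have h4 : (2 * ((n : ℝ) - 1) - 1) / n.choose 2
        ≤ ((crossing {u} ∪ crossing {v}).card : ℝ) / n.choose 2 := by
      gcongr; linarith
    refine (sub_le_sub_left h4 1).trans ?_
    rw [cast_choose_two_eq, ← sub_nonneg]
    have : (1 - 2 / (n : ℝ)) ^ 2 - (1 - (2 * ((n : ℝ) - 1) - 1) / (n * (n - 1) / 2))
        = (2 * n - 4) / (n ^ 2 * (n - 1)) := by
      field_simp; ring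
    rw [this]
    apply div_nonneg <;> [linarith; positivity]

lemma tendsto_neg_log_one_sub_two_div_mul :
    Tendsto (fun n : ℕ => -Real.log (1 - 2 / (n : ℝ)) * (n / 2)) atTop (𝓝 1) := by
  have h := (Real.tendsto_mul_log_one_add_div_atTop (-2)).comp tendsto_natCast_atTop_atTop
  have h2 := h.mul_const (-(1 / 2) : ℝ)
  rw [show (-2 : ℝ) * -(1 / 2) = 1 by norm_num] at h2
  refine h2.congr fun n => ?_
  simp only [Function.comp_apply]
  rw [show (1 : ℝ) + -2 / n = 1 - 2 / n by ring]
  ring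

/-! ### Above the threshold: union bound over cuts. -/

/-- The contribution of the cuts of size `k` to the union bound, without the factor `n ^ (-ε)`,
is at most the `k`-th term of a convergent series. -/
lemma choose_mul_rpow_le {n k : ℕ} (hn : 2 ≤ n) (hk : 1 ≤ k) (hkn : 2 * k ≤ n) :
    (n.choose k : ℝ) * (n : ℝ) ^ (-(k * (n - k) / (n - 1) : ℝ))
      ≤ ((1 / 4 : ℝ) ^ k + (8 * Real.exp 1) ^ k / k.factorial) / 2 := by
  have hn' : (2 : ℝ) ≤ n := by exact_mod_cast hn
  have hk' : (1 : ℝ) ≤ k := by exact_mod_cast hk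
  have hkn' : 2 * (k : ℝ) ≤ n := by exact_mod_cast hkn
  have hn0 : (0 : ℝ) < n := by linarith
  have hn1 : (0 : ℝ) < n - 1 := by linarith
  have hf : (0 : ℝ) < k.factorial := by exact_mod_cast k.factorial_pos
  set y : ℝ := (n : ℝ) ^ (k * (k - 1) / (n - 1) : ℝ) with hy
  have hy0 : 0 < y := by positivity
  set T : ℝ := (n.choose k : ℝ) * (n : ℝ) ^ (-(k * (n - k) / (n - 1) : ℝ)) with hT
  have hT0 : 0 ≤ T := by positivity
  -- The exponent of `y` is `k - k (n - k) / (n - 1)`.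
  have hTy : T ≤ y / k.factorial := by
    have hexp : (n : ℝ) ^ (-(k * (n - k) / (n - 1) : ℝ)) = y / (n : ℝ) ^ k := by
      rw [hy, ← Real.rpow_natCast, ← Real.rpow_sub hn0]
      congr 1
      field_simp; ring
    rw [hT, hexp]
    have hc : (n.choose k : ℝ) ≤ (n : ℝ) ^ k / k.factorial := Nat.choose_le_pow_div k n
    calc (n.choose k : ℝ) * (y / (n : ℝ) ^ k)
        ≤ (n : ℝ) ^ k / k.factorial * (y / (n : ℝ) ^ k) := by gcongr
      _ = y / k.factorial := by field_simp
  have hlog : (k - 1) * (Real.log n / (n - 1)) ≤ Real.log (2 * k) / 2 := by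
    -- Chord slopes of `log` from `1` decrease, and `2 * k ≤ n`.
    have hslope : Real.log n / (n - 1) ≤ Real.log (2 * k) / (2 * k - 1) := by
      rcases hkn'.eq_or_lt with heq | hlt
      · rw [← heq]
      have := strictConcaveOn_log_Ioi.concaveOn.slope_anti_adjacent (x := 1) (y := 2 * (k : ℝ))
        (z := n) (by simp) (by simpa using hn0) (by linarith) hlt
      rw [Real.log_one, sub_zero] at this
      rw [div_le_div_iff₀ (by linarith) (by linarith)] at this ⊢
      nlinarith
    have hl0 : 0 ≤ Real.log (2 * k) := Real.log_nonneg (by linarith)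
    calc (k - 1) * (Real.log n / (n - 1)) ≤ (k - 1) * (Real.log (2 * k) / (2 * k - 1)) :=
          mul_le_mul_of_nonneg_left hslope (by linarith)
      _ ≤ Real.log (2 * k) / 2 := by
          rw [mul_div_assoc', div_le_div_iff₀ (by linarith) (by norm_num)]
          nlinarith
  have hy2 : y ^ 2 ≤ (2 * k) ^ k := by
    have h1 : y ^ 2 = Real.exp (2 * (k * ((k - 1) * (Real.log n / (n - 1))))) := by
      rw [hy, Real.rpow_def_of_pos hn0, ← Real.exp_nat_mul]
      congr 1
      push_cast; field_simp
    have h2 : ((2 : ℝ) * k) ^ k = Real.exp (2 * (k * (Real.log (2 * k) / 2))) := by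
      rw [show 2 * ((k : ℝ) * (Real.log (2 * k) / 2)) = k * Real.log (2 * k) by ring,
        Real.exp_nat_mul, Real.exp_log (by linarith)]
    rw [h1, h2]
    gcongr
  have hkk : (k : ℝ) ^ k ≤ Real.exp 1 ^ k * k.factorial := by
    have := Real.pow_div_factorial_le_exp (k : ℝ) (by linarith) k
    rwa [div_le_iff₀ hf, ← Real.exp_one_pow] at this
  have hT2 : T ^ 2 ≤ (2 * Real.exp 1) ^ k / k.factorial := by
    calc T ^ 2 ≤ (y / k.factorial) ^ 2 := by gcongr
      _ = y ^ 2 / k.factorial ^ 2 := div_pow _ _ _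
      _ ≤ (2 ^ k * (Real.exp 1 ^ k * k.factorial)) / k.factorial ^ 2 := by
          rw [mul_pow] at hy2
          gcongr
          exact hy2.trans (by gcongr)
      _ = (2 * Real.exp 1) ^ k / k.factorial := by rw [mul_pow]; field_simp
  -- AM-GM replaces the square root of `hT2` by summable terms; the weights `2 ^ k` make the first
  -- one geometric.
  have hsq := two_mul_le_add_sq ((1 / 2 : ℝ) ^ k) (2 ^ k * T)
  have e1 : (2 : ℝ) * (1 / 2) ^ k * (2 ^ k * T) = 2 * T := by
    rw [show (2 : ℝ) * (1 / 2) ^ k * (2 ^ k * T) = 2 * ((1 / 2) ^ k * 2 ^ k) * T by ring,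
      ← mul_pow]; norm_num
  have e2 : ((1 / 2 : ℝ) ^ k) ^ 2 = (1 / 4) ^ k := by
    rw [← pow_mul, mul_comm, pow_mul]; norm_num
  have e3 : ((2 : ℝ) ^ k * T) ^ 2 ≤ (8 * Real.exp 1) ^ k / k.factorial := by
    rw [mul_pow, ← pow_mul, mul_comm k 2, pow_mul,
      show (8 : ℝ) * Real.exp 1 = 2 ^ 2 * (2 * Real.exp 1) by ring, mul_pow (2 ^ 2 : ℝ),
      mul_div_assoc]
    gcongr
  rw [e1, e2] at hsq
  linarith

/-- A bound for the sum over all sizes of the terms in `choose_mul_rpow_le`. -/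
noncomputable def cutConstant : ℝ := (4 / 3 + Real.exp (8 * Real.exp 1)) / 2

lemma cutConstant_pos : 0 < cutConstant := by unfold cutConstant; positivity

lemma sum_le_cutConstant (s : Finset ℕ) :
    ∑ k ∈ s, ((1 / 4 : ℝ) ^ k + (8 * Real.exp 1) ^ k / k.factorial) / 2 ≤ cutConstant := by
  rw [← Finset.sum_div, Finset.sum_add_distrib, cutConstant]
  have h1 : ∑ k ∈ s, (1 / 4 : ℝ) ^ k ≤ 4 / 3 := by
    have := hasSum_geometric_of_lt_one (r := (1 / 4 : ℝ)) (by norm_num) (by norm_num)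
    refine (sum_le_hasSum s (fun _ _ => by positivity) this).trans (by norm_num)
  have h2 : ∑ k ∈ s, (8 * Real.exp 1) ^ k / k.factorial ≤ Real.exp (8 * Real.exp 1) := by
    have := NormedSpace.expSeries_div_hasSum_exp (8 * Real.exp 1)
    rw [← Real.exp_eq_exp_ℝ] at this
    exact sum_le_hasSum s (fun _ _ => by positivity) this
  linarith

lemma one_sub_pow_le_rpow {n k t : ℕ} {ε : ℝ} (hε : 0 < ε) (hn : 2 ≤ n) (hk : 1 ≤ k)
    (hkn : 2 * k ≤ n) (ht : (n : ℝ) * Real.log n / 2 * (1 + ε) ≤ t)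
    (hp : (k * (n - k) : ℝ) / (n * (n - 1) / 2) ≤ 1) :
    (1 - (k * (n - k) : ℝ) / (n * (n - 1) / 2)) ^ t
      ≤ (n : ℝ) ^ (-(k * (n - k) / (n - 1) : ℝ)) * (n : ℝ) ^ (-ε) := by
  have hn' : (2 : ℝ) ≤ n := by exact_mod_cast hn
  have hk' : (1 : ℝ) ≤ k := by exact_mod_cast hk
  have hkn' : 2 * (k : ℝ) ≤ n := by exact_mod_cast hkn
  have hn0 : (0 : ℝ) < n := by linarith
  have hn1 : (0 : ℝ) < n - 1 := by linarith
  set p : ℝ := (k * (n - k) : ℝ) / (n * (n - 1) / 2) with hpdef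
  set c : ℝ := (k * (n - k) / (n - 1) : ℝ) with hc
  -- This lets `n ^ (-c * ε)` be weakened to `n ^ (-ε)`, uniformly in `k`.
  have hc1 : 1 ≤ c := by
    rw [hc, le_div_iff₀ hn1]; nlinarith
  have hpc : p * (n / 2) = c := by rw [hpdef, hc]; field_simp
  have hp0 : 0 ≤ p := by
    have : (0 : ℝ) ≤ n - k := by linarith
    positivity
  have hlog : 0 ≤ Real.log n := Real.log_nonneg (by linarith)
  calc (1 - p) ^ t ≤ Real.exp (-p) ^ t := by
        refine pow_le_pow_left₀ (by linarith) ?_ t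
        linarith [Real.add_one_le_exp (-p)]
    _ = Real.exp (-(p * t)) := by rw [← Real.exp_nat_mul]; congr 1; ring
    _ ≤ Real.exp (Real.log n * (-c + -ε)) := by
        rw [Real.exp_le_exp]
        have h1 := mul_le_mul_of_nonneg_left ht hp0
        have h2 : p * ((n : ℝ) * Real.log n / 2 * (1 + ε)) = c * Real.log n * (1 + ε) := by
          rw [← hpc]; ring
        rw [h2] at h1
        have h3 : 0 ≤ (c - 1) * (Real.log n * ε) := by
          have : 0 ≤ c - 1 := by linarith
          positivity
        nlinarith
    _ = (n : ℝ) ^ (-c) * (n : ℝ) ^ (-ε) := by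
        rw [← Real.rpow_add hn0, Real.rpow_def_of_pos hn0]

lemma IsUniformEdgeSequence.measureReal_not_isConnected_le {n : ℕ} (hn : 2 ≤ n) {Ω : Type*}
    [MeasurableSpace Ω] {P : Measure Ω} [IsProbabilityMeasure P] {e : ℕ → Ω → Edge n}
    (h : IsUniformEdgeSequence P e) {ε : ℝ} (hε : 0 < ε) {t : ℕ}
    (ht : (n : ℝ) * Real.log n / 2 * (1 + ε) ≤ t) :
    P.real {ω | ¬ IsConnected (multigraph (fun s => e s ω) t)}
      ≤ cutConstant * (n : ℝ) ^ (-ε) := by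
  classical
  set K : Finset ℕ := (Finset.range (n + 1)).filter fun k => 1 ≤ k ∧ 2 * k ≤ n with hK
  have hsub : {ω | ¬ IsConnected (multigraph (fun s => e s ω) t)} ⊆
      ⋃ k ∈ K, ⋃ S ∈ Finset.univ.powersetCard k, {ω | ∀ s < t, e s ω ∉ crossing S} := by
    intro ω hω
    obtain ⟨S, hS, hS2, hcut⟩ := exists_cut_of_not_isConnected (by omega) hω
    simp only [Set.mem_iUnion]
    refine ⟨S.card, ?_, S, ?_, hcut⟩
    · have := hS.card_pos
      simp only [hK, Finset.mem_filter, Finset.mem_range]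
      omega
    · simp
  have hterm : ∀ k ∈ K, P.real (⋃ S ∈ (Finset.univ : Finset (Fin n)).powersetCard k,
      {ω | ∀ s < t, e s ω ∉ crossing S})
      ≤ (((1 / 4 : ℝ) ^ k + (8 * Real.exp 1) ^ k / k.factorial) / 2) * (n : ℝ) ^ (-ε) := by
    intro k hk
    simp only [hK, Finset.mem_filter, Finset.mem_range] at hk
    have hS : ∀ S ∈ (Finset.univ : Finset (Fin n)).powersetCard k,
        P.real {ω | ∀ s < t, e s ω ∉ crossing S}
          ≤ (n : ℝ) ^ (-(k * (n - k) / (n - 1) : ℝ)) * (n : ℝ) ^ (-ε) := by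
      intro S hS
      have hcard := (Finset.mem_powersetCard.1 hS).2
      have hfrac : ((crossing S).card : ℝ) / n.choose 2
          = (k * (n - k) : ℝ) / (n * (n - 1) / 2) := by
        rw [card_crossing, hcard, cast_choose_two_eq, Nat.cast_mul, Nat.cast_sub (by omega)]
      rw [h.measureReal_avoid, hfrac]
      refine one_sub_pow_le_rpow hε hn hk.2.1 hk.2.2 ht ?_
      rw [← hfrac, ← h.measureReal_mem _ 0]
      exact measureReal_le_one
    refine (measureReal_biUnion_finset_le _ _).trans ((Finset.sum_le_sum hS).trans ?_)
    rw [Finset.sum_const, Finset.card_powersetCard, Finset.card_univ, Fintype.card_fin,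
      nsmul_eq_mul, ← mul_assoc]
    gcongr
    exact choose_mul_rpow_le hn hk.2.1 hk.2.2
  calc P.real {ω | ¬ IsConnected (multigraph (fun s => e s ω) t)}
      ≤ P.real (⋃ k ∈ K, ⋃ S ∈ Finset.univ.powersetCard k,
          {ω | ∀ s < t, e s ω ∉ crossing S}) := measureReal_mono hsub (measure_ne_top _ _)
    _ ≤ ∑ k ∈ K, P.real (⋃ S ∈ Finset.univ.powersetCard k,
          {ω | ∀ s < t, e s ω ∉ crossing S}) := measureReal_biUnion_finset_le _ _
    _ ≤ ∑ k ∈ K, (((1 / 4 : ℝ) ^ k + (8 * Real.exp 1) ^ k / k.factorial) / 2)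
          * (n : ℝ) ^ (-ε) := Finset.sum_le_sum hterm
    _ ≤ cutConstant * (n : ℝ) ^ (-ε) := by
        rw [← Finset.sum_mul]
        gcongr
        exact sum_le_cutConstant K

/-! ### Error exponents and conclusion. -/

/-- The error term in the exponent of the upper bound below the threshold. -/
noncomputable def subcriticalError (ε : ℝ) (n : ℕ) : ℝ :=
  -- At `n = 2` the logarithm degenerates; the value `ε` makes the bound the trivial `1`.
  if n ≤ 2 then ε else ε - 1 + (1 - ε) * (-Real.log (1 - 2 / (n : ℝ)) * (n / 2))

lemma tendsto_subcriticalError (ε : ℝ) : Tendsto (subcriticalError ε) atTop (𝓝 0) := by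
  have h := (tendsto_neg_log_one_sub_two_div_mul.const_mul (1 - ε)).const_add (ε - 1)
  rw [show ε - 1 + (1 - ε) * 1 = 0 by ring] at h
  refine h.congr' ?_
  filter_upwards [eventually_gt_atTop 2] with n hn
  rw [subcriticalError, if_neg (by omega)]

lemma IsUniformEdgeSequence.measureReal_isConnected_le_rpow {n : ℕ} (hn : 2 ≤ n) {Ω : Type*}
    [MeasurableSpace Ω] {P : Measure Ω} [IsProbabilityMeasure P] {e : ℕ → Ω → Edge n}
    (h : IsUniformEdgeSequence P e) {ε : ℝ} {t : ℕ}
    (ht : (t : ℝ) ≤ (n : ℝ) * Real.log n / 2 * (1 - ε)) :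
    P.real {ω | IsConnected (multigraph (fun s => e s ω) t)}
      ≤ (n : ℝ) ^ (-ε + subcriticalError ε n) := by
  rcases hn.eq_or_lt with rfl | hn3
  · simp [subcriticalError]
  have hn' : (3 : ℝ) ≤ n := by exact_mod_cast hn3
  have hn0 : (0 : ℝ) < n := by linarith
  have hq : (0 : ℝ) < 1 - 2 / n := by
    rw [sub_pos, div_lt_one hn0]; linarith
  have hq1 : Real.log (1 - 2 / (n : ℝ)) ≤ 0 := by
    refine Real.log_nonpos hq.le ?_
    have : (0 : ℝ) ≤ 2 / n := by positivity
    linarith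
  refine (h.measureReal_isConnected_le hn3 t).trans ?_
  have e1 : 1 / (n * (1 - 2 / n : ℝ) ^ t)
      = Real.exp (-(Real.log n + t * Real.log (1 - 2 / (n : ℝ)))) := by
    rw [Real.exp_neg, Real.exp_add, Real.exp_nat_mul, Real.exp_log hn0, Real.exp_log hq,
      one_div]
  rw [e1, Real.rpow_def_of_pos hn0, Real.exp_le_exp, subcriticalError, if_neg (by omega)]
  have := mul_le_mul_of_nonneg_right ht (neg_nonneg.2 hq1)
  nlinarith

end RandomMultigraph

theorem mainTheorem8 (ε : ℝ) (hε : 0 < ε) :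
    (∃ δ : ℕ → ℝ, Tendsto δ atTop (𝓝 0) ∧
      ∀ n : ℕ, 2 ≤ n →
      ∀ (Ω : Type*) [MeasurableSpace Ω] (P : Measure Ω) [IsProbabilityMeasure P]
        (e : ℕ → Ω → RandomMultigraph.Edge n),
        RandomMultigraph.IsUniformEdgeSequence P e →
      ∀ t : ℕ, (t : ℝ) ≤ (n : ℝ) * Real.log n / 2 * (1 - ε) →
        P.real {ω | RandomMultigraph.IsConnected
            (RandomMultigraph.multigraph (fun s => e s ω) t)} ≤ (n : ℝ) ^ (-ε + δ n)) ∧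
    (∃ δ : ℕ → ℝ, Tendsto δ atTop (𝓝 0) ∧
      ∀ n : ℕ, 2 ≤ n →
      ∀ (Ω : Type*) [MeasurableSpace Ω] (P : Measure Ω) [IsProbabilityMeasure P]
        (e : ℕ → Ω → RandomMultigraph.Edge n),
        RandomMultigraph.IsUniformEdgeSequence P e →
      ∀ t : ℕ, (n : ℝ) * Real.log n / 2 * (1 + ε) ≤ (t : ℝ) →
        1 - (n : ℝ) ^ (-ε + δ n) ≤ P.real {ω | RandomMultigraph.IsConnected
            (RandomMultigraph.multigraph (fun s => e s ω) t)}) := by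
  refine ⟨⟨RandomMultigraph.subcriticalError ε, RandomMultigraph.tendsto_subcriticalError ε,
    fun n hn Ω _ P _ e h t ht => h.measureReal_isConnected_le_rpow hn ht⟩,
    -- Chosen so that `n ^ δ n` equals the constant `cutConstant`.
    ⟨fun n => Real.log RandomMultigraph.cutConstant / Real.log n,
      (Real.tendsto_log_atTop.comp tendsto_natCast_atTop_atTop).const_div_atTop _,
      fun n hn Ω _ P _ e h t ht => ?_⟩⟩
  have hn' : (1 : ℝ) < n := by exact_mod_cast hn
  have hdisc := h.measureReal_not_isConnected_le hn hε ht
  have hpow : (n : ℝ) ^ (-ε + Real.log RandomMultigraph.cutConstant / Real.log n)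
      = RandomMultigraph.cutConstant * (n : ℝ) ^ (-ε) := by
    rw [Real.rpow_add (by linarith), mul_comm, Real.rpow_def_of_pos (by linarith),
      mul_div_cancel₀ _ (Real.log_pos hn').ne', Real.exp_log RandomMultigraph.cutConstant_pos]
  have hunion := measureReal_union_le (μ := P)
    {ω | RandomMultigraph.IsConnected (RandomMultigraph.multigraph (fun s => e s ω) t)}
    {ω | ¬ RandomMultigraph.IsConnected (RandomMultigraph.multigraph (fun s => e s ω) t)}
  rw [show {ω | RandomMultigraph.IsConnected (RandomMultigraph.multigraph (fun s => e s ω) t)} ∪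
    {ω | ¬ RandomMultigraph.IsConnected (RandomMultigraph.multigraph (fun s => e s ω) t)}
      = Set.univ from Set.union_compl_self _, probReal_univ] at hunion
  rw [hpow]
  linarith
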